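/- Let $F$ be a field of characteristic $\neq 2$, let $\ell>g\ge 0$ be integers, and let $X$ be the smooth projective (hyperelliptic) curve of genus $g$ over $F$ with affine equation $y^2=f(x)$, where $f\in F[x]$ is separable of degree $2g+1$; let $\infty_X$ be the point of $X$ over $x=\infty$. The $2\ell-g+1$ functions $$\lambda=(1,\,y,\,x,\,xy,\dots,x^{\ell-g-1},\,x^{\ell-g-1}y;\ x^{\ell-g},\,x^{\ell-g+1},\dots,x^{\ell})$$ form an $F$-basis of $H^0(X,\mathcal O(2\ell\infty_X))$. Let $p=(\gamma,0)\neq\infty_X$ be a ramification point of $(x,y)\mapsto x$, that is, a (not necessarily $F$-rational) closed point of the affine curve at which $y$ vanishes, and let $\mathcal O_{X,p}$ be its local ring, with maximal ideal $\mathfrak m_p$. There is exactly one sequence $(D^k_y)_{k\ge0}$ of $F$-linear maps $\mathcal O_{X,p}\to\mathcal O_{X,p}$ with $D^0_y=\mathrm{id}$, $D^k_y(ab)=\sum_{i=0}^kD^i_y(a)\,D^{k-i}_y(b)$ for all $k\ge 0$ and $a,b\in\mathcal O_{X,p}$, $D^1_y(y)=1$, and $D^k_y(y)=0$ for $k\ge2$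 (the Hasse derivatives with respect to the étale coordinate $y$). Let $$w(\lambda)=\det\bigl(D^k_y\lambda_j\bigr)_{0\le k,j\le 2\ell-g}\in\mathcal O_{X,p}$$ be the Hasse Wronskian of $\lambda$ with respect to $y$, and let $M(\ell,g)$ be the integer $(g+1)\times(g+1)$ matrix with entries $M_{ij}=\binom{\ell-g+j}{2j-i}$, $0\le i,j\le g$ (where $\binom{a}{b}=0$ for $b<0$). If $\det M(\ell,g)\neq0$ in $F$, then $w(\lambda)$ and $$\det M(\ell,g)\cdot\left(D^1_yx\right)^{\binom{g+1}{2}}\left(D^2_yx\right)^{\ell(\ell-g)}$$ have the same lowest-order term at $p$: both have the same finite order of vanishing $n$ at $p$, and they have the same class in $\mathfrak m_p^n/\mathfrak m_p^{n+1}$. -/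

import Mathlib

open Polynomial

namespace HyperellipticInflection

/-- The coordinate ring `F[x, y] / (y ^ 2 - f(x))` of the affine part `X ∖ {∞_X}` of the
hyperelliptic curve `X` with affine equation `y ^ 2 = f(x)`. -/
abbrev CoordRing {F : Type*} [Field F] (f : F[X]) : Type _ :=
  AdjoinRoot (X ^ 2 - C f : F[X][X])

/-- The coordinate function `x` on the affine curve. -/
noncomputable def xCoord {F : Type*} [Field F] (f : F[X]) : CoordRing f :=
  AdjoinRoot.of (X ^ 2 - C f : F[X][X]) X

/-- The coordinate function `y` on the affine curve. -/
noncomputable def yCoord {F : Type*} [Field F] (f : F[X]) : CoordRing f :=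
  AdjoinRoot.root (X ^ 2 - C f : F[X][X])

/-- The ring of functions on the chart of `X` around `∞_X`, with coordinates `z = x⁻¹` and
`w = x^{-(g+1)} y`, as a subalgebra of the ring `F[x, y, x⁻¹] / (y ^ 2 - f(x))` of functions on
the overlap (the locus `x ≠ 0`) of the two charts. -/
noncomputable def chartAtInfinity {F : Type*} [Field F] (f : F[X]) (g : ℕ) :
    Subalgebra F (Localization.Away (xCoord f)) :=
  Algebra.adjoin F
    {IsLocalization.Away.invSelf (xCoord f),
      IsLocalization.Away.invSelf (xCoord f) ^ (g + 1) *
        algebraMap (CoordRing f) (Localization.Away (xCoord f)) (yCoord f)}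

/-- The space of global sections `H⁰(X, 𝒪(2ℓ∞_X))`: as `2∞_X` is the divisor of `z = x⁻¹` on the
chart around `∞_X`, the sheaf is generated by `1` on the affine part and by `x ^ ℓ` on the chart
around `∞_X`; a global section is a function on the affine part which, on the overlap, is `x ^ ℓ`
times a function on the chart around `∞_X`. -/
noncomputable def globalSections {F : Type*} [Field F] (f : F[X]) (g ℓ : ℕ) :
    Submodule F (CoordRing f) :=
  Submodule.comap
    (IsScalarTower.toAlgHom F (CoordRing f) (Localization.Away (xCoord f))).toLinearMap
    (Submodule.map
      (LinearMap.mulLeft F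
        (algebraMap (CoordRing f) (Localization.Away (xCoord f)) (xCoord f) ^ ℓ))
      (Subalgebra.toSubmodule (chartAtInfinity f g)))

/-- The sequence `(1, y, x, xy, …, x^{ℓ-g-1}, x^{ℓ-g-1} y; x^{ℓ-g}, x^{ℓ-g+1}, …, x^ℓ)`
of length `2ℓ - g + 1` (meant for `g < ℓ`). -/
noncomputable def monomials {F : Type*} [Field F] (f : F[X]) (g ℓ : ℕ) :
    Fin (2 * ℓ - g + 1) → CoordRing f := fun j =>
  if (j : ℕ) < 2 * (ℓ - g) then
    if Even (j : ℕ) then xCoord f ^ ((j : ℕ) / 2) else xCoord f ^ ((j : ℕ) / 2) * yCoord f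
  else xCoord f ^ ((j : ℕ) - (ℓ - g))

/-- `D 0, D 1, D 2, …` are the Hasse derivatives of the `F`-algebra `R` with respect to the
coordinate `t`: the sequence of `F`-linear maps with `D 0 = id`, the Hasse-Leibniz rule, and
`D 1 t = 1`, `D k t = 0` for `k ≥ 2`. (On polynomials in `t` these conditions give
`D k (t ^ i) = (i choose k) t ^ (i - k)`.) -/
structure IsHasseDerivatives (F : Type*) {R : Type*} [Field F] [CommRing R] [Algebra F R]
    (t : R) (D : ℕ → R →ₗ[F] R) : Prop where
  zero : D 0 = LinearMap.id
  leibniz : ∀ (k : ℕ) (a b : R),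
    D k (a * b) = ∑ p ∈ Finset.HasAntidiagonal.antidiagonal k, D p.1 a * D p.2 b
  coord_one : D 1 t = 1
  coord_ge_two : ∀ k : ℕ, 2 ≤ k → D k t = 0

/-- The Hasse Wronskian: the determinant of the matrix whose row `k` consists of the `k`-th
Hasse derivatives of the functions `s 0, …, s (n - 1)`. -/
def hasseWronskian {F R : Type*} [Field F] [CommRing R] [Algebra F R]
    (D : ℕ → R →ₗ[F] R) {n : ℕ} (s : Fin n → R) : R :=
  (Matrix.of fun k j : Fin n => D (k : ℕ) (s j)).det

/-- The integer `(g + 1) × (g + 1)` matrix with entries `(ℓ - g + j choose 2 j - i)`,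
`0 ≤ i, j ≤ g`, where a binomial coefficient with negative lower entry is `0`. -/
def pathMatrix (g ℓ : ℕ) : Matrix (Fin (g + 1)) (Fin (g + 1)) ℤ :=
  Matrix.of fun i j =>
    if (i : ℕ) ≤ 2 * (j : ℕ) then
      ((Nat.choose (ℓ - g + (j : ℕ)) (2 * (j : ℕ) - (i : ℕ)) : ℕ) : ℤ)
    else 0

/-- Two elements `u`, `v` of a local ring with maximal ideal `𝔪` have the same lowest-order term:
both have the same finite order of vanishing `n`, and the same class in `𝔪 ^ n / 𝔪 ^ (n + 1)`. -/
def SameLowestOrderTerm {R : Type*} [CommRing R] [IsLocalRing R] (u v : R) : Prop :=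
  ∃ n : ℕ,
    u ∈ IsLocalRing.maximalIdeal R ^ n ∧ u ∉ IsLocalRing.maximalIdeal R ^ (n + 1) ∧
    v ∈ IsLocalRing.maximalIdeal R ^ n ∧ v ∉ IsLocalRing.maximalIdeal R ^ (n + 1) ∧
    u - v ∈ IsLocalRing.maximalIdeal R ^ (n + 1)

end HyperellipticInflection

/-! Hasse derivatives in `y` amount to one algebra homomorphism, the Taylor expansion `a ↦ ∑ D k a T
^ k` into `R⟦T⟧`, which sends `y` to `y + T` and `x` to `x + v`, where `v = (D 1 x) T + (D 2 x) T² +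
⋯`. It exists and is unique by Hensel's lemma applied to `f(x + v) = (y + T)²`, since separability
makes `f'(x)` a unit at a point with `y = 0`. The Wronskian is the determinant of the coefficients
of the series `(x + v)^i (y + T)^e`, and unitriangular column operations replace these by `v^i T^e`
(`pow_mul_linear_sub_mem_span`).

Comparing coefficients gives `f'(x) D 1 x = 2 y` and `f'(x) D 2 x ≡ 1` mod `𝔪 = (y)`, so `D 1 x = y
c` with `c` a unit. Hence `v(yT) = y² v'(T)` with `v' ≡ c T + (D 2 x) T²` mod `𝔪`. Substituting `yT`
for `T` multiplies row `k` by `y^k` and pulls `y^(2i+e)` out of the column of `x^i y^e`; the surplus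
is `(g+1 choose 2)`. So the Wronskian is `y ^ (g+1 choose 2) * W` (`exists_det_eq_pow_mul`), and the
residue of `W` is the same determinant for the quadratic `aT + bT²`, which `det_quadratic` evaluates
through `pathMatrix`.

The basis statement is a degree count in `CoordRing f = F[x] ⊕ F[x] y`, with poles at infinity
bounded by `exists_of_mem_chartAtInfinity`. -/

namespace HyperellipticInflection

/-! ### Exponents and weights of the monomials -/

/-- The exponent of `x` in the `j`-th monomial. -/
def xExp (m j : ℕ) : ℕ := if j < 2 * m then j / 2 else j - m

/-- The exponent of `y` in the `j`-th monomial. -/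
def yExp (m j : ℕ) : ℕ := if j < 2 * m then j % 2 else 0

/-- With weights 2 for `x` and 1 for `y`, the first `2m` monomials have weight equal to their index;
the last `g + 1` overshoot by `0, 1, …, g`. The total overshoot is the order of vanishing of the
Wronskian. -/
theorem two_mul_xExp_add_yExp (m j : ℕ) : 2 * xExp m j + yExp m j = j + (j - 2 * m) := by
  unfold xExp yExp
  split_ifs <;> omega

theorem sum_range_tsub (m g : ℕ) :
    ∑ j ∈ Finset.range (2 * m + (g + 1)), (j - 2 * m) = (g + 1).choose 2 := by
  rw [Finset.sum_range_add, Finset.sum_eq_zero (fun j hj => by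
    have := Finset.mem_range.1 hj; omega), zero_add]
  simp only [Nat.add_sub_cancel_left]
  rw [Finset.sum_range_id, Nat.choose_two_right]

theorem prod_pow_weight {R : Type*} [CommRing R] (y : R) (m g : ℕ) :
    ∏ j : Fin (2 * m + (g + 1)), y ^ (2 * xExp m j + yExp m j) =
      (∏ j : Fin (2 * m + (g + 1)), y ^ (j : ℕ)) * y ^ (g + 1).choose 2 := by
  simp only [two_mul_xExp_add_yExp, pow_add, Finset.prod_mul_distrib]
  congr 1
  rw [Finset.prod_pow_eq_pow_sum, Fin.sum_univ_eq_sum_range (fun j => j - 2 * m), sum_range_tsub]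

/-! ### Determinants of power series coefficients -/

/-- A unitriangular change of the columns does not change the determinant. -/
theorem det_eq_of_sub_mem_span {R M : Type*} [CommRing R] [AddCommGroup M] [Module R M] {n : ℕ}
    (L : Fin n → M →ₗ[R] R) (s s' : Fin n → M)
    (h : ∀ j, s j - s' j ∈ Submodule.span R (s' '' Set.Iio j)) :
    (Matrix.of fun k j => L k (s j)).det = (Matrix.of fun k j => L k (s' j)).det := by
  have h' : ∀ j, ∃ c : Fin n → R, (∀ i, j ≤ i → c i = 0) ∧ s j - s' j = ∑ i, c i • s' i := by
    intro j
    obtain ⟨l, hl, e⟩ := (Finsupp.mem_span_image_iff_linearCombination R).1 (h j)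
    refine ⟨l, fun i hi => ?_, ?_⟩
    · by_contra hne
      have := (Finsupp.mem_supported R l).1 hl (Finsupp.mem_support_iff.2 hne)
      exact absurd hi (not_le.2 this)
    · rw [← e, Finsupp.linearCombination_apply, Finsupp.sum_fintype _ _ (by simp)]
  choose c hc hs using h'
  have key : (Matrix.of fun k j => L k (s j)) =
      (Matrix.of fun k j => L k (s' j)) * (1 + Matrix.of fun i j => c j i) := by
    ext k j
    rw [Matrix.mul_add, Matrix.mul_one, Matrix.add_apply, Matrix.mul_apply]
    have e : s j = s' j + ∑ i, c j i • s' i := by rw [← hs]; abel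
    simp only [Matrix.of_apply]
    conv_lhs => rw [e]
    simp only [map_add, map_sum, map_smul, smul_eq_mul, mul_comm]
  rw [key, Matrix.det_mul, Matrix.det_of_isUpperTriangular (M := 1 + _), Finset.prod_eq_one, mul_one]
  · intro i _
    simp [hc i i le_rfl]
  · intro i j hij
    have hij' : j < i := hij
    simp [hc j i hij'.le, Matrix.one_apply_ne hij'.ne']

theorem coeff_linear_pow {R : Type*} [CommRing R] (a b : R) (i d : ℕ) :
    PowerSeries.coeff d ((PowerSeries.C a + PowerSeries.C b * PowerSeries.X) ^ i) =
      i.choose d * a ^ (i - d) * b ^ d := by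
  have : (PowerSeries.C a + PowerSeries.C b * PowerSeries.X) ^ i =
      (((C a + C b * X) ^ i : R[X]) : PowerSeries R) := by
    simp
  have hterm : ∀ k ∈ Finset.range (i + 1), (C b * X) ^ k * C a ^ (i - k) * (i.choose k : R[X]) =
      C (i.choose k * a ^ (i - k) * b ^ k) * X ^ k := by
    intro k _
    simp only [map_mul, map_pow, map_natCast, mul_pow]
    ring
  rw [this, Polynomial.coeff_coe, add_comm, add_pow, Finset.sum_congr rfl hterm]
  simp only [finsetSum_coeff, coeff_C_mul_X_pow, Finset.sum_ite_eq, Finset.mem_range]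
  split_ifs with h
  · rfl
  · rw [Nat.choose_eq_zero_of_lt (by omega)]
    simp

theorem coeff_quadratic_pow {R : Type*} [CommRing R] (a b : R) (i e k : ℕ) :
    PowerSeries.coeff k ((PowerSeries.X * (PowerSeries.C a + PowerSeries.C b * PowerSeries.X)) ^ i *
        PowerSeries.X ^ e) =
      if i + e ≤ k then (i.choose (k - (i + e)) : R) * a ^ (i - (k - (i + e))) * b ^ (k - (i + e))
      else 0 := by
  have : (PowerSeries.X * (PowerSeries.C a + PowerSeries.C b * PowerSeries.X)) ^ i *
        PowerSeries.X ^ e =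
      PowerSeries.X ^ (i + e) * (PowerSeries.C a + PowerSeries.C b * PowerSeries.X) ^ i := by
    rw [mul_pow, pow_add]
    ring
  rw [this, PowerSeries.coeff_X_pow_mul']
  simp only [coeff_linear_pow]

theorem sum_range_div_two (m : ℕ) : ∑ j ∈ Finset.range (2 * m), j / 2 = m * (m - 1) := by
  induction m with
  | zero => simp
  | succ m ih =>
    rw [show 2 * (m + 1) = 2 * m + 1 + 1 by ring, Finset.sum_range_succ, Finset.sum_range_succ, ih,
      show (2 * m + 1) / 2 = m by omega, show 2 * m / 2 = m by omega]
    cases m with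
    | zero => rfl
    | succ k => simp only [Nat.add_sub_cancel]; ring

/-- Symmetry of binomial coefficients turns the lower entry `m + i - r` into `2r - i`. The powers of
`a` and `b` then separate into a row factor and a column factor; where either lower entry would be
negative, both sides vanish. -/
theorem pathMatrix_apply_mul {K : Type*} [CommRing K] (a b : K) (m g : ℕ) (i r : Fin (g + 1)) :
    a ^ (i : ℕ) * (b ^ (r : ℕ) *
      (if m + (r : ℕ) ≤ 2 * m + i then ((m + (r : ℕ)).choose (2 * m + i - (m + r)) : K) *
        a ^ (m + (r : ℕ) - (2 * m + i - (m + r))) * b ^ (2 * m + (i : ℕ) - (m + r)) else 0)) =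
      b ^ (m + (i : ℕ)) * ((a ^ 2) ^ (r : ℕ) * ((pathMatrix g (g + m) i r : ℤ) : K)) := by
  obtain ⟨i, hi⟩ := i
  obtain ⟨r, hr⟩ := r
  simp only [pathMatrix, Matrix.of_apply, Nat.add_sub_cancel_left]
  by_cases h1 : i ≤ 2 * r
  · by_cases h2 : m + r ≤ 2 * m + i
    · rw [if_pos h1, if_pos h2, ← Nat.choose_symm_of_eq_add (a := 2 * r - i) (by omega),
        show m + r - (2 * m + i - (m + r)) = 2 * r - i by omega]
      obtain ⟨d, hd⟩ := Nat.exists_eq_add_of_le h1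
      obtain ⟨q, hq⟩ := Nat.exists_eq_add_of_le h2
      rw [← pow_mul, hd, show m + i = r + q by omega, hq]
      simp only [Nat.add_sub_cancel_left, pow_add]
      push_cast
      ring
    · rw [if_pos h1, if_neg h2, Nat.choose_eq_zero_of_lt (show m + r < 2 * r - i by omega)]
      simp
  · rw [if_neg h1, if_pos (by omega), Nat.choose_eq_zero_of_lt (by omega)]
    simp

/-- For `j < 2m` the column is a polynomial in `T` of degree `j` at most, with `T^j`-coefficient
`b^(j/2)`, so the matrix is block upper triangular with a triangular first block. The last block is
`pathMatrix` up to diagonal scalings. -/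
theorem det_quadratic {K : Type*} [Field K] {a b : K} (ha : a ≠ 0) (hb : b ≠ 0) (m g : ℕ) :
    (Matrix.of fun k j : Fin (2 * m + (g + 1)) =>
      PowerSeries.coeff (k : ℕ)
        ((PowerSeries.X * (PowerSeries.C a + PowerSeries.C b * PowerSeries.X)) ^ xExp m j *
          PowerSeries.X ^ yExp m j)).det =
      ((pathMatrix g (g + m)).det : K) * a ^ (g + 1).choose 2 * b ^ ((g + m) * m) := by
  simp only [coeff_quadratic_pow]
  set A : Matrix (Fin (2 * m + (g + 1))) (Fin (2 * m + (g + 1))) K := Matrix.of _ with hA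
  set B : Matrix (Fin (2 * m) ⊕ Fin (g + 1)) (Fin (2 * m) ⊕ Fin (g + 1)) K :=
    A.submatrix finSumFinEquiv finSumFinEquiv with hB
  have h21 : B.toBlocks₂₁ = 0 := by
    ext i j
    have := j.2
    simp only [hB, hA, Matrix.toBlocks₂₁, Matrix.of_apply, Matrix.submatrix_apply,
      finSumFinEquiv_apply_left, finSumFinEquiv_apply_right, Fin.val_natAdd, Fin.val_castAdd,
      xExp, yExp, if_pos this, Matrix.zero_apply]
    split_ifs
    · rw [Nat.choose_eq_zero_of_lt (by omega)]
      simp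
    · rfl
  have h11 : B.toBlocks₁₁.det = b ^ (m * (m - 1)) := by
    rw [Matrix.det_of_isUpperTriangular]
    · rw [← sum_range_div_two, ← Finset.prod_pow_eq_pow_sum, Finset.prod_range]
      refine Finset.prod_congr rfl fun j _ => ?_
      simp only [hB, hA, Matrix.toBlocks₁₁, Matrix.of_apply, Matrix.submatrix_apply,
        finSumFinEquiv_apply_left, Fin.val_castAdd, xExp, yExp, if_pos j.2]
      rw [if_pos (by omega), show (j : ℕ) - (j / 2 + j % 2) = j / 2 by omega]
      simp
    · intro i j hij
      have hij' : (j : ℕ) < i := hij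
      simp only [hB, hA, Matrix.toBlocks₁₁, Matrix.of_apply, Matrix.submatrix_apply,
        finSumFinEquiv_apply_left, Fin.val_castAdd, xExp, yExp, if_pos j.2]
      split_ifs
      · rw [Nat.choose_eq_zero_of_lt (by omega)]
        simp
      · rfl
  have hs : ∑ i : Fin (g + 1), (i : ℕ) = (g + 1).choose 2 := by
    rw [Fin.sum_univ_eq_sum_range (fun i => i), Finset.sum_range_id, Nat.choose_two_right]
  have h22 : B.toBlocks₂₂.det =
      ((pathMatrix g (g + m)).det : K) * a ^ (g + 1).choose 2 * b ^ (m * (g + 1)) := by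
    have e1 : (Matrix.of fun i r : Fin (g + 1) => a ^ (i : ℕ) *
        (Matrix.of fun i r : Fin (g + 1) => b ^ (r : ℕ) * B.toBlocks₂₂ i r) i r) =
        Matrix.of fun i r : Fin (g + 1) => b ^ (m + (i : ℕ)) *
          (Matrix.of fun i r : Fin (g + 1) => (a ^ 2) ^ (r : ℕ) *
            ((pathMatrix g (g + m)).map (Int.castRingHom K)) i r) i r := by
      ext i r
      rw [Matrix.of_apply, Matrix.of_apply, Matrix.of_apply, Matrix.of_apply, Matrix.map_apply,
        eq_intCast, ← pathMatrix_apply_mul]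
      simp only [hB, hA, Matrix.toBlocks₂₂, Matrix.of_apply, Matrix.submatrix_apply,
        finSumFinEquiv_apply_right, Fin.val_natAdd, xExp, yExp,
        if_neg (show ¬ 2 * m + (r : ℕ) < 2 * m by omega), add_zero,
        show 2 * m + (r : ℕ) - m = m + r by omega]
    have e2 := congrArg Matrix.det e1
    rw [Matrix.det_mul_column, Matrix.det_mul_row, Matrix.det_mul_column, Matrix.det_mul_row,
      ← RingHom.mapMatrix_apply, ← RingHom.map_det, eq_intCast] at e2
    simp only [Finset.prod_pow_eq_pow_sum, Finset.sum_add_distrib, hs, Finset.sum_const,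
      Finset.card_univ, Fintype.card_fin, smul_eq_mul] at e2
    -- The row and column scalings of `e1` are invertible because `a` and `b` are nonzero, so they
    -- can be cancelled from the determinants.
    have hne : a ^ (g + 1).choose 2 * b ^ (g + 1).choose 2 ≠ 0 :=
      mul_ne_zero (pow_ne_zero _ ha) (pow_ne_zero _ hb)
    apply mul_left_cancel₀ hne
    rw [mul_assoc, e2, pow_add, mul_comm m]
    ring
  have hdet : A.det = B.det := (Matrix.det_submatrix_equiv_self _ _).symm
  rw [hdet, ← Matrix.fromBlocks_toBlocks B, h21, Matrix.det_fromBlocks_zero₂₁, h11, h22,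
    show (g + m) * m = m * (m - 1) + m * (g + 1) by
      cases m with
      | zero => simp
      | succ k => simp only [Nat.add_sub_cancel]; ring, pow_add]
  ring

/-- Expanding the product, every term other than the leading one has smaller exponents, and the
corresponding monomial occurs earlier in the list. -/
theorem pow_mul_linear_sub_mem_span {R : Type*} [CommRing R] (m g : ℕ) (x y : R)
    (v : PowerSeries R) (j : Fin (2 * m + (g + 1))) :
    (PowerSeries.C x + v) ^ xExp m j * (PowerSeries.C y + PowerSeries.X) ^ yExp m j -
      v ^ xExp m j * PowerSeries.X ^ yExp m j ∈
      Submodule.span R ((fun j : Fin (2 * m + (g + 1)) =>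
        v ^ xExp m j * PowerSeries.X ^ yExp m j) '' Set.Iio j) := by
  set S := Submodule.span R ((fun j : Fin (2 * m + (g + 1)) =>
        v ^ xExp m j * PowerSeries.X ^ yExp m j) '' Set.Iio j) with hS
  have hmem : ∀ k < (j : ℕ), v ^ xExp m k * PowerSeries.X ^ yExp m k ∈ S := fun k hk =>
    Submodule.subset_span ⟨⟨k, by omega⟩, hk, rfl⟩
  have hpow : ∀ i < xExp m j, v ^ i ∈ S := by
    intro i hi
    unfold xExp at hi
    by_cases h : i < m
    · have := hmem (2 * i) (by split_ifs at hi <;> omega)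
      rwa [xExp, yExp, if_pos (by omega), if_pos (by omega), show 2 * i / 2 = i by omega,
        show 2 * i % 2 = 0 by omega, pow_zero, mul_one] at this
    · have := hmem (m + i) (by split_ifs at hi <;> omega)
      rwa [xExp, yExp, if_neg (by omega), if_neg (by omega), Nat.add_sub_cancel_left,
        pow_zero, mul_one] at this
  have hexp : ∀ w : PowerSeries R, (∀ i < xExp m j, v ^ i * w ∈ S) →
      (PowerSeries.C x + v) ^ xExp m j * w - v ^ xExp m j * w ∈ S := by
    intro w hw
    rw [add_comm, add_pow, Finset.sum_range_succ, Nat.sub_self, pow_zero, mul_one, Nat.choose_self,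
      Nat.cast_one, mul_one, add_mul, add_sub_cancel_right, Finset.sum_mul]
    refine Submodule.sum_mem _ fun i hi => ?_
    have : v ^ i * PowerSeries.C x ^ (xExp m j - i) * ((xExp m j).choose i : PowerSeries R) * w =
        (x ^ (xExp m j - i) * ((xExp m j).choose i : R)) • (v ^ i * w) := by
      rw [PowerSeries.smul_eq_C_mul, map_mul, map_pow, map_natCast]
      ring
    rw [this]
    exact S.smul_mem _ (hw i (Finset.mem_range.1 hi))
  have hy : yExp m j = 0 ∨ yExp m j = 1 := by
    unfold yExp
    split_ifs <;> omega
  rcases hy with hy | hy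
  · rw [hy, pow_zero, pow_zero]
    exact hexp 1 fun i hi => by simpa using hpow i hi
  · rw [hy, pow_one, pow_one]
    have hj : (j : ℕ) < 2 * m ∧ (j : ℕ) % 2 = 1 := by
      unfold yExp at hy
      split_ifs at hy
      exact ⟨by assumption, hy⟩
    have hx : xExp m j = j / 2 := if_pos hj.1
    have h1 := hexp PowerSeries.X fun i hi => by
      have := hmem (2 * i + 1) (by omega)
      rwa [xExp, yExp, if_pos (by omega), if_pos (by omega), show (2 * i + 1) / 2 = i by omega,
        show (2 * i + 1) % 2 = 1 by omega, pow_one] at this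
    have h2 := hexp 1 fun i hi => by simpa using hpow i hi
    have h3 : v ^ xExp m j ∈ S := by
      have := hmem (2 * xExp m j) (by omega)
      rwa [xExp, yExp, if_pos (by omega), if_pos (by omega), hx,
        show 2 * ((j : ℕ) / 2) / 2 = j / 2 by omega,
        show 2 * ((j : ℕ) / 2) % 2 = 0 by omega, pow_zero, mul_one, ← hx] at this
    have h4 := S.add_mem h1 (S.smul_mem y (S.add_mem h2 h3))
    convert h4 using 1
    rw [PowerSeries.smul_eq_C_mul]
    ring

/-- The Hasse Wronskian of the monomials is the expected power of `y` times an element with an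
explicit residue. -/
theorem exists_det_eq_pow_mul {R K : Type*} [CommRing R] [IsDomain R] [Field K] (ρ : R →+* K)
    {y : R} (hy : y ≠ 0) (hρy : ρ y = 0) {n m g : ℕ}
    (hn : n = 2 * m + (g + 1)) (φ : PowerSeries R) {c : R}
    (hc : PowerSeries.coeff 1 φ = y * c) (hρc : ρ c ≠ 0) (hρ2 : ρ (PowerSeries.coeff 2 φ) ≠ 0) :
    ∃ W : R, (Matrix.of fun k j : Fin n => PowerSeries.coeff (k : ℕ)
        (φ ^ xExp m j * (PowerSeries.C y + PowerSeries.X) ^ yExp m j)).det =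
        y ^ (g + 1).choose 2 * W ∧
      ρ W = ((pathMatrix g (g + m)).det : K) * ρ c ^ (g + 1).choose 2 *
        ρ (PowerSeries.coeff 2 φ) ^ ((g + m) * m) := by
  subst hn
  set v : PowerSeries R := φ - PowerSeries.C (PowerSeries.coeff 0 φ) with hv
  -- This is `v(yT) / y²`: the linear coefficient of `v` supplies its own factor `y`, and the
  -- coefficients from degree 3 on keep a factor `y`, so they die in the residue field.
  set v' : PowerSeries R := PowerSeries.mk fun k =>
    if k = 0 then 0 else if k = 1 then c else y ^ (k - 2) * PowerSeries.coeff k φ with hv'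
  have hφ : φ = PowerSeries.C (PowerSeries.coeff 0 φ) + v := by rw [hv]; ring
  have hscale : PowerSeries.rescale y v = PowerSeries.C (y ^ 2) * v' := by
    ext k
    rw [PowerSeries.coeff_rescale, PowerSeries.coeff_C_mul, hv, hv', PowerSeries.coeff_mk, map_sub,
      PowerSeries.coeff_C]
    rcases k with _ | _ | k
    · simp
    · simp [hc]
      ring
    · simp only [Nat.add_eq_zero_iff, one_ne_zero, and_false, if_false, sub_zero,
        Nat.add_eq_right, show k + 1 + 1 - 2 = k by omega]
      ring
  have hmap : PowerSeries.map ρ v' = PowerSeries.X *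
      (PowerSeries.C (ρ c) + PowerSeries.C (ρ (PowerSeries.coeff 2 φ)) * PowerSeries.X) := by
    ext k
    rw [PowerSeries.coeff_map, hv', PowerSeries.coeff_mk]
    rcases k with _ | _ | _ | k
    · simp
    · rw [PowerSeries.coeff_succ_X_mul]
      simp
    · rw [PowerSeries.coeff_succ_X_mul]
      simp [PowerSeries.coeff_C, PowerSeries.coeff_succ_mul_X]
    · rw [PowerSeries.coeff_succ_X_mul]
      simp [PowerSeries.coeff_succ_mul_X, hρy]
  refine ⟨(Matrix.of fun k j : Fin (2 * m + (g + 1)) => PowerSeries.coeff (k : ℕ)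
        (v' ^ xExp m j * PowerSeries.X ^ yExp m j)).det, ?_, ?_⟩
  · have hd := det_eq_of_sub_mem_span (R := R) (M := PowerSeries R)
      (fun k : Fin (2 * m + (g + 1)) => PowerSeries.coeff (k : ℕ))
      (fun j => φ ^ xExp m j * (PowerSeries.C y + PowerSeries.X) ^ yExp m j)
      (fun j => v ^ xExp m j * PowerSeries.X ^ yExp m j)
      (fun j => by
        have := pow_mul_linear_sub_mem_span m g (PowerSeries.coeff 0 φ) y v j
        rwa [← hφ] at this)
    rw [hd]
    -- The substitution of `yT` for `T`, read once on the rows and once on the columns.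
    have hmat : (Matrix.of fun k j : Fin (2 * m + (g + 1)) => y ^ (k : ℕ) *
        (Matrix.of fun k j : Fin (2 * m + (g + 1)) => PowerSeries.coeff (k : ℕ)
          (v ^ xExp m j * PowerSeries.X ^ yExp m j)) k j) =
        Matrix.of fun k j : Fin (2 * m + (g + 1)) => y ^ (2 * xExp m j + yExp m j) *
        (Matrix.of fun k j : Fin (2 * m + (g + 1)) => PowerSeries.coeff (k : ℕ)
          (v' ^ xExp m j * PowerSeries.X ^ yExp m j)) k j := by
      ext k j
      simp only [Matrix.of_apply]
      rw [← PowerSeries.coeff_rescale, ← PowerSeries.coeff_C_mul]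
      congr 1
      rw [map_mul, map_pow, map_pow, hscale, PowerSeries.rescale_X]
      simp only [mul_pow, pow_add, pow_mul, map_mul, map_pow]
      ring
    have hdet := congrArg Matrix.det hmat
    rw [Matrix.det_mul_column, Matrix.det_mul_row, prod_pow_weight, mul_assoc] at hdet
    exact mul_left_cancel₀ (Finset.prod_ne_zero_iff.2 fun _ _ => pow_ne_zero _ hy) hdet
  · rw [← det_quadratic hρc hρ2, RingHom.map_det]
    congr 1
    ext k j
    rw [RingHom.mapMatrix_apply, Matrix.map_apply, Matrix.of_apply, Matrix.of_apply,
      ← PowerSeries.coeff_map, map_mul, map_pow, map_pow, hmap, PowerSeries.map_X]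

/-! ### The coordinate ring as `F[x] ⊕ F[x] y` -/

variable {F : Type*} [Field F]

theorem yCoord_sq (f : F[X]) : yCoord f ^ 2 = algebraMap F[X] (CoordRing f) f := by
  have h := AdjoinRoot.eval₂_root (X ^ 2 - C f : F[X][X])
  rw [eval₂_sub, eval₂_pow, eval₂_X, eval₂_C, sub_eq_zero] at h
  exact h

theorem algebraMap_X (f : F[X]) : algebraMap F[X] (CoordRing f) X = xCoord f := rfl

theorem exists_repr (f : F[X]) (u : CoordRing f) :
    ∃ a b : F[X], u = algebraMap F[X] _ a + algebraMap F[X] _ b * yCoord f := by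
  obtain ⟨p, rfl⟩ := AdjoinRoot.mk_surjective u
  induction p using Polynomial.induction_on' with
  | add p q hp hq =>
    obtain ⟨a, b, h⟩ := hp
    obtain ⟨a', b', h'⟩ := hq
    exact ⟨a + a', b + b', by rw [map_add, h, h', map_add, map_add]; ring⟩
  | monomial n c =>
    rw [← C_mul_X_pow_eq_monomial, map_mul, map_pow, AdjoinRoot.mk_X, AdjoinRoot.mk_C]
    change ∃ a b : F[X], algebraMap F[X] (CoordRing f) c * yCoord f ^ n = _
    rcases Nat.even_or_odd' n with ⟨k, rfl | rfl⟩
    · exact ⟨c * f ^ k, 0, by rw [pow_mul, yCoord_sq]; simp⟩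
    · exact ⟨0, c * f ^ k, by rw [pow_succ (yCoord f), pow_mul, yCoord_sq]; simp [mul_assoc]⟩

theorem repr_eq_zero {f a b : F[X]}
    (h : algebraMap F[X] (CoordRing f) a + algebraMap F[X] _ b * yCoord f = 0) :
    a = 0 ∧ b = 0 := by
  have h1 : AdjoinRoot.mk (X ^ 2 - C f : F[X][X]) (C b * X + C a) = 0 := by
    rw [map_add, map_mul, AdjoinRoot.mk_X, AdjoinRoot.mk_C, AdjoinRoot.mk_C, add_comm]
    exact h
  rw [AdjoinRoot.mk_eq_zero] at h1
  have h2 := eq_zero_of_dvd_of_degree_lt h1 (by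
    rw [degree_X_pow_sub_C (by norm_num)]
    exact degree_linear_lt)
  have hb := congrArg (coeff · 1) h2
  have ha := congrArg (coeff · 0) h2
  simp at ha hb
  exact ⟨ha, hb⟩

theorem repr_injective {f a b a' b' : F[X]}
    (h : algebraMap F[X] (CoordRing f) a + algebraMap F[X] _ b * yCoord f =
      algebraMap F[X] (CoordRing f) a' + algebraMap F[X] _ b' * yCoord f) :
    a = a' ∧ b = b' := by
  have := repr_eq_zero (f := f) (a := a - a') (b := b - b') (by
    rw [map_sub, map_sub]
    linear_combination h)
  exact ⟨sub_eq_zero.1 this.1, sub_eq_zero.1 this.2⟩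

/-- A reducible monic quadratic would have a root, making `f` a square, which its odd degree
forbids. -/
theorem isDomain_coordRing {f : F[X]} (hf : Odd f.natDegree) : IsDomain (CoordRing f) := by
  have hirr : Irreducible (X ^ 2 - C f : F[X][X]) := by
    have hm : (X ^ 2 - C f : F[X][X]).Monic := monic_X_pow_sub_C f two_ne_zero
    have hd : (X ^ 2 - C f : F[X][X]).natDegree = 2 := natDegree_X_pow_sub_C
    rw [hm.irreducible_iff_roots_eq_zero_of_degree_le_three hd.ge (by omega)]
    refine Multiset.eq_zero_of_forall_notMem fun r hr => ?_
    have h := isRoot_of_mem_roots hr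
    simp only [IsRoot.def, eval_sub, eval_pow, eval_X, eval_C, sub_eq_zero] at h
    rw [← h, natDegree_pow] at hf
    exact absurd hf (by simp)
  exact AdjoinRoot.isDomain_of_prime hirr.prime

theorem xCoord_ne_zero (f : F[X]) : xCoord f ≠ 0 := fun h =>
  X_ne_zero (repr_eq_zero (f := f) (a := X) (b := 0) (by rw [map_zero, zero_mul, add_zero]; exact h)).1

theorem yCoord_ne_zero (f : F[X]) : yCoord f ≠ 0 := fun h =>
  one_ne_zero (repr_eq_zero (f := f) (a := 0) (b := 1) (by rw [h]; simp)).2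

theorem monomials_eq (f : F[X]) (g ℓ : ℕ) (j : Fin (2 * ℓ - g + 1)) :
    monomials f g ℓ j = xCoord f ^ xExp (ℓ - g) j * yCoord f ^ yExp (ℓ - g) j := by
  unfold monomials xExp yExp
  split_ifs with h1 h2
  · rw [Nat.even_iff.1 h2, pow_zero, mul_one]
  · rw [Nat.not_even_iff.1 h2, pow_one]
  · rw [pow_zero, mul_one]

/-! ### The basis of the space of global sections -/

/-- The `F`-linear map `(a, b) ↦ a(x) + b(x) y`. -/
noncomputable def ofPair (f : F[X]) : F[X] × F[X] →ₗ[F] CoordRing f :=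
  (IsScalarTower.toAlgHom F F[X] (CoordRing f)).toLinearMap.coprod
    ((LinearMap.mulRight F (yCoord f)).comp
      (IsScalarTower.toAlgHom F F[X] (CoordRing f)).toLinearMap)

theorem ofPair_apply (f a b : F[X]) : ofPair f (a, b) =
    algebraMap F[X] (CoordRing f) a + algebraMap F[X] _ b * yCoord f := by
  simp [ofPair]

theorem linearIndependent_monomials (f : F[X]) (g ℓ : ℕ) :
    LinearIndependent F (monomials f g ℓ) := by
  -- The list consists of distinct members of the standard basis `x^i`, `x^i y` of the coordinate
  -- ring.
  set idx : Fin (2 * ℓ - g + 1) → ℕ ⊕ ℕ := fun j =>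
    if yExp (ℓ - g) j = 0 then Sum.inl (xExp (ℓ - g) j) else Sum.inr (xExp (ℓ - g) j) with hidx
  have hinj : Function.Injective idx := by
    intro i j hij
    rw [hidx] at hij
    ext
    unfold xExp yExp at hij
    dsimp only at hij
    split_ifs at hij <;> simp at hij <;> omega
  have hli := ((((basisMonomials F).prod (basisMonomials F)).linearIndependent).comp idx hinj).map'
    (ofPair f) (by
      rw [LinearMap.ker_eq_bot']
      rintro ⟨a, b⟩ h
      rw [ofPair_apply] at h
      obtain ⟨rfl, rfl⟩ := repr_eq_zero h
      rfl)
  suffices h : monomials f g ℓ = ofPair f ∘ (basisMonomials F).prod (basisMonomials F) ∘ idx by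
    rw [h]
    exact hli
  funext j
  rw [monomials_eq]
  have hy : yExp (ℓ - g) j = 0 ∨ yExp (ℓ - g) j = 1 := by
    unfold yExp
    split_ifs <;> omega
  simp only [Function.comp_apply, hidx]
  rcases hy with hy | hy
  · rw [if_pos hy, hy, Module.Basis.prod_apply, Sum.elim_inl]
    simp [ofPair_apply, ← X_pow_eq_monomial]
    rfl
  · rw [if_neg (by omega), hy, Module.Basis.prod_apply, Sum.elim_inr]
    simp [ofPair_apply, ← X_pow_eq_monomial]
    rfl

theorem monomials_mem_globalSections (f : F[X]) {g ℓ : ℕ} (hgl : g < ℓ)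
    (j : Fin (2 * ℓ - g + 1)) : monomials f g ℓ j ∈ globalSections f g ℓ := by
  set A := Localization.Away (xCoord f)
  set z : A := IsLocalization.Away.invSelf (xCoord f)
  have hxz : algebraMap (CoordRing f) A (xCoord f) * z = 1 :=
    IsLocalization.Away.mul_invSelf (xCoord f)
  have hz : z ∈ chartAtInfinity f g := Algebra.subset_adjoin (Or.inl rfl)
  have hw : z ^ (g + 1) * algebraMap (CoordRing f) A (yCoord f) ∈ chartAtInfinity f g :=
    Algebra.subset_adjoin (Or.inr rfl)
  have hcancel : ∀ n, algebraMap (CoordRing f) A (xCoord f) ^ n * z ^ n = 1 := fun n => by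
    rw [← mul_pow, hxz, one_pow]
  rw [monomials_eq]
  have hy : yExp (ℓ - g) j = 0 ∨
      yExp (ℓ - g) j = 1 ∧ xExp (ℓ - g) j + (g + 1) ≤ ℓ := by
    unfold yExp xExp
    split_ifs <;> omega
  have hx : xExp (ℓ - g) j ≤ ℓ := by
    unfold xExp
    split_ifs <;> omega
  rcases hy with hy | ⟨hy, hxy⟩
  · obtain ⟨d, hd⟩ := Nat.exists_eq_add_of_le hx
    refine ⟨z ^ d, pow_mem hz d, ?_⟩
    rw [LinearMap.mulLeft_apply, hy]
    conv_lhs => rw [hd]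
    simp only [AlgHom.toLinearMap_apply, IsScalarTower.coe_toAlgHom', map_pow, pow_zero,
      mul_one, pow_add]
    rw [mul_assoc, hcancel, mul_one]
  · obtain ⟨d, hd⟩ := Nat.exists_eq_add_of_le hxy
    refine ⟨z ^ d * _, (chartAtInfinity f g).mul_mem (pow_mem hz d) hw, ?_⟩
    rw [LinearMap.mulLeft_apply, hy]
    conv_lhs => rw [hd]
    simp only [AlgHom.toLinearMap_apply, IsScalarTower.coe_toAlgHom', map_mul, map_pow, pow_one,
      pow_add _ _ d, pow_add _ _ (g + 1)]
    linear_combination (algebraMap (CoordRing f) A (xCoord f) ^ xExp (ℓ - g) j *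
      algebraMap (CoordRing f) A (yCoord f)) * (algebraMap (CoordRing f) A (xCoord f) ^ (g + 1) *
        z ^ (g + 1) * hcancel d + hcancel (g + 1))

/-- A function on the chart around `∞_X` times a power of `x` is of the form `a(x) + b(x) y` with
bounds on the degrees. -/
theorem exists_of_mem_chartAtInfinity {f : F[X]} {g : ℕ} (hdeg : f.natDegree ≤ 2 * g + 1)
    {c : Localization.Away (xCoord f)} (hc : c ∈ chartAtInfinity f g) :
    ∃ (N : ℕ) (a b : F[X]), a.degree ≤ N ∧ b.degree + ((g + 1 : ℕ) : WithBot ℕ) ≤ N ∧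
      algebraMap (CoordRing f) (Localization.Away (xCoord f)) (xCoord f) ^ N * c =
        algebraMap (CoordRing f) (Localization.Away (xCoord f))
          (algebraMap F[X] _ a + algebraMap F[X] _ b * yCoord f) := by
  have hxz : algebraMap (CoordRing f) (Localization.Away (xCoord f)) (xCoord f) *
    IsLocalization.Away.invSelf (xCoord f) = 1 := IsLocalization.Away.mul_invSelf (xCoord f)
  have hf : f.degree ≤ ((g + 1 : ℕ) : WithBot ℕ) + (g : ℕ) := by
    refine degree_le_natDegree.trans ?_
    rw [← Nat.cast_add]
    exact_mod_cast (by omega : f.natDegree ≤ g + 1 + g)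
  have hg : ((g : ℕ) : WithBot ℕ) ≤ ((g + 1 : ℕ) : WithBot ℕ) := by exact_mod_cast Nat.le_succ g
  induction hc using Algebra.adjoin_induction with
  | mem c hc =>
    rcases hc with rfl | rfl
    · exact ⟨1, 1, 0, by simp, by simp, by simp [hxz]⟩
    · refine ⟨g + 1, 0, 1, by simp, by simp, ?_⟩
      rw [← mul_assoc, ← mul_pow, hxz]
      simp
  | algebraMap r =>
    refine ⟨0, C r, 0, degree_C_le, by simp, ?_⟩
    rw [IsScalarTower.algebraMap_apply F (CoordRing f) (Localization.Away (xCoord f)),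
      IsScalarTower.algebraMap_apply F F[X] (CoordRing f)]
    simp
  | add c c' _ _ ih ih' =>
    obtain ⟨N, a, b, ha, hb, h⟩ := ih
    obtain ⟨N', a', b', ha', hb', h'⟩ := ih'
    refine ⟨N + N', X ^ N' * a + X ^ N * a', X ^ N' * b + X ^ N * b', ?_, ?_, ?_⟩
    · refine (degree_add_le _ _).trans (max_le ?_ ?_)
      · rw [degree_mul, degree_X_pow, Nat.cast_add, add_comm]
        gcongr
      · rw [degree_mul, degree_X_pow, Nat.cast_add]
        gcongr
    · have : (X ^ N' * b + X ^ N * b').degree ≤ max (N' + b.degree) (N + b'.degree) := by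
        refine (degree_add_le _ _).trans ?_
        rw [degree_mul, degree_X_pow, degree_mul, degree_X_pow]
      refine (add_le_add_left this _).trans ?_
      rcases max_cases ((N' : WithBot ℕ) + b.degree) (N + b'.degree) with ⟨e, -⟩ | ⟨e, -⟩
      · rw [e, add_assoc, Nat.cast_add N, add_comm (N : WithBot ℕ)]
        gcongr
      · rw [e, add_assoc, Nat.cast_add N]
        gcongr
    · simp only [map_add, map_mul, map_pow, algebraMap_X] at h h' ⊢
      linear_combination
        algebraMap (CoordRing f) (Localization.Away (xCoord f)) (xCoord f) ^ N' * h +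
        algebraMap (CoordRing f) (Localization.Away (xCoord f)) (xCoord f) ^ N * h'
  | mul c c' _ _ ih ih' =>
    obtain ⟨N, a, b, ha, hb, h⟩ := ih
    obtain ⟨N', a', b', ha', hb', h'⟩ := ih'
    refine ⟨N + N', a * a' + b * b' * f, a * b' + b * a', ?_, ?_, ?_⟩
    · rw [Nat.cast_add]
      refine (degree_add_le _ _).trans (max_le ?_ ?_)
      · rw [degree_mul]
        gcongr
      · rw [degree_mul, degree_mul]
        -- The product of the two `y`-parts contributes `y² = f`, and `deg f ≤ 2(g + 1)` is absorbed
        -- by the two slacks `g + 1`.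
        calc b.degree + b'.degree + f.degree
            ≤ b.degree + b'.degree + (((g + 1 : ℕ) : WithBot ℕ) + ((g + 1 : ℕ) : WithBot ℕ)) := by
              gcongr
              exact hf.trans (by gcongr)
          _ = (b.degree + ((g + 1 : ℕ) : WithBot ℕ)) + (b'.degree + ((g + 1 : ℕ) : WithBot ℕ)) :=
              add_add_add_comm _ _ _ _
          _ ≤ N + N' := by gcongr
    · have : (a * b' + b * a').degree ≤ max (a.degree + b'.degree) (b.degree + a'.degree) := by
        refine (degree_add_le _ _).trans ?_
        rw [degree_mul, degree_mul]
      refine (add_le_add_left this _).trans ?_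
      rcases max_cases (a.degree + b'.degree) (b.degree + a'.degree) with ⟨e, -⟩ | ⟨e, -⟩
      · rw [e, add_assoc, Nat.cast_add N]
        gcongr
      · rw [e, add_right_comm, Nat.cast_add N]
        gcongr
    · have hy := congrArg (algebraMap (CoordRing f) (Localization.Away (xCoord f))) (yCoord_sq f)
      simp only [map_add, map_mul, map_pow, pow_add] at h h' hy ⊢
      linear_combination
        (algebraMap (CoordRing f) (Localization.Away (xCoord f)) (xCoord f) ^ N' * c') * h +
        (algebraMap (CoordRing f) (Localization.Away (xCoord f)) (algebraMap F[X] _ a) +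
          algebraMap (CoordRing f) (Localization.Away (xCoord f)) (algebraMap F[X] _ b) *
          algebraMap (CoordRing f) (Localization.Away (xCoord f)) (yCoord f)) * h' +
        (algebraMap (CoordRing f) (Localization.Away (xCoord f)) (algebraMap F[X] _ b) *
          algebraMap (CoordRing f) (Localization.Away (xCoord f)) (algebraMap F[X] _ b')) * hy

theorem span_monomials {f : F[X]} {g ℓ : ℕ} (hgl : g < ℓ) (hdeg : f.natDegree = 2 * g + 1) :
    Submodule.span F (Set.range (monomials f g ℓ)) = globalSections f g ℓ := by
  apply le_antisymm
  · rw [Submodule.span_le]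
    rintro _ ⟨j, rfl⟩
    exact monomials_mem_globalSections f hgl j
  rintro u ⟨c, hc, hu⟩
  have := isDomain_coordRing (f := f) ⟨g, hdeg⟩
  have hinj : Function.Injective (algebraMap (CoordRing f) (Localization.Away (xCoord f))) :=
    IsLocalization.injective _ (powers_le_nonZeroDivisors_of_noZeroDivisors (xCoord_ne_zero f))
  obtain ⟨N, a, b, ha, hb, h⟩ := exists_of_mem_chartAtInfinity hdeg.le hc
  obtain ⟨p, q, rfl⟩ := exists_repr f u
  -- Multiplying by `x^N` clears the denominators at infinity; comparing `F[x]`-components then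
  -- bounds the degrees of `p` and `q`.
  have key : algebraMap F[X] (CoordRing f) (X ^ N * p) +
      algebraMap F[X] (CoordRing f) (X ^ N * q) * yCoord f =
      algebraMap F[X] (CoordRing f) (X ^ ℓ * a) +
      algebraMap F[X] (CoordRing f) (X ^ ℓ * b) * yCoord f := by
    apply hinj
    simp only [LinearMap.mulLeft_apply, AlgHom.toLinearMap_apply,
      IsScalarTower.coe_toAlgHom', map_mul, map_add, map_pow, algebraMap_X] at hu h ⊢
    linear_combination
      algebraMap (CoordRing f) (Localization.Away (xCoord f)) (xCoord f) ^ ℓ * h -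
      algebraMap (CoordRing f) (Localization.Away (xCoord f)) (xCoord f) ^ N * hu
  obtain ⟨hp, hq⟩ := repr_injective key
  have hpd : p.natDegree ≤ ℓ := by
    by_cases h0 : p = 0
    · simp [h0]
    have := congrArg degree hp
    rw [degree_mul, degree_mul, degree_X_pow, degree_X_pow, degree_eq_natDegree h0] at this
    have h2 : ((N + p.natDegree : ℕ) : WithBot ℕ) ≤ ((ℓ + N : ℕ) : WithBot ℕ) := by
      push_cast
      rw [this]
      gcongr
    have := Nat.cast_le.1 h2
    omega
  have hqd : q = 0 ∨ q.natDegree + (g + 1) ≤ ℓ := by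
    by_cases h0 : q = 0
    · exact Or.inl h0
    have := congrArg degree hq
    rw [degree_mul, degree_mul, degree_X_pow, degree_X_pow, degree_eq_natDegree h0] at this
    have h2 : ((N + q.natDegree + (g + 1) : ℕ) : WithBot ℕ) ≤ ((ℓ + N : ℕ) : WithBot ℕ) := by
      rw [Nat.cast_add, Nat.cast_add, this, add_assoc, Nat.cast_add ℓ]
      gcongr
    have := Nat.cast_le.1 h2
    omega
  have hspan : ∀ j < 2 * ℓ - g + 1, xCoord f ^ xExp (ℓ - g) j * yCoord f ^ yExp (ℓ - g) j ∈
      Submodule.span F (Set.range (monomials f g ℓ)) := fun j hj =>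
    Submodule.subset_span ⟨⟨j, hj⟩, monomials_eq f g ℓ _⟩
  have hsum : ∀ r : F[X], algebraMap F[X] (CoordRing f) r =
      ∑ i ∈ Finset.range (r.natDegree + 1), r.coeff i • xCoord f ^ i := by
    intro r
    conv_lhs => rw [r.as_sum_range_C_mul_X_pow]
    rw [map_sum]
    refine Finset.sum_congr rfl fun i _ => ?_
    rw [map_mul, map_pow, algebraMap_X, Algebra.smul_def,
      IsScalarTower.algebraMap_apply F F[X] (CoordRing f)]
    rfl
  apply Submodule.add_mem
  · rw [hsum]
    refine Submodule.sum_mem _ fun i hi => Submodule.smul_mem _ _ ?_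
    have hi' := Finset.mem_range.1 hi
    by_cases him : i < ℓ - g
    · have := hspan (2 * i) (by omega)
      rwa [xExp, yExp, if_pos (by omega), if_pos (by omega), show 2 * i / 2 = i by omega,
        show 2 * i % 2 = 0 by omega, pow_zero, mul_one] at this
    · have := hspan (ℓ - g + i) (by omega)
      rwa [xExp, yExp, if_neg (by omega), if_neg (by omega), Nat.add_sub_cancel_left,
        pow_zero, mul_one] at this
  · rcases hqd with rfl | hqd
    · simp
    rw [hsum, Finset.sum_mul]
    refine Submodule.sum_mem _ fun i hi => ?_
    rw [smul_mul_assoc]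
    refine Submodule.smul_mem _ _ ?_
    have hi' := Finset.mem_range.1 hi
    have := hspan (2 * i + 1) (by omega)
    rwa [xExp, yExp, if_pos (by omega), if_pos (by omega), show (2 * i + 1) / 2 = i by omega,
      show (2 * i + 1) % 2 = 1 by omega, pow_one] at this

/-! ### Simple roots in power series rings -/

theorem exists_aeval_add {S : Type*} [CommRing S] [Algebra F S] (f : F[X]) (u d : S) :
    ∃ k : S, aeval (u + d) f = aeval u f + aeval u (derivative f) * d + k * d ^ 2 := by
  obtain ⟨k, hk⟩ := (f.map (algebraMap F S)).binomExpansion u d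
  refine ⟨k, ?_⟩
  rwa [derivative_map, eval_map_algebraMap, eval_map_algebraMap, eval_map_algebraMap] at hk

theorem constantCoeff_aeval {R : Type*} [CommRing R] [Algebra F R] (f : F[X])
    (u : PowerSeries R) :
    PowerSeries.constantCoeff (aeval u f) = aeval (PowerSeries.constantCoeff u) f := by
  rw [aeval_def, aeval_def, hom_eval₂]
  congr 1

/-- Simple roots of polynomials lift uniquely to power series. -/
theorem aeval_powerSeries_injective {R : Type*} [CommRing R] [Algebra F R] {f : F[X]}
    {u v : PowerSeries R} (h0 : PowerSeries.constantCoeff u = PowerSeries.constantCoeff v)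
    (hu : IsUnit (aeval (PowerSeries.constantCoeff u) (derivative f)))
    (h : aeval u f = aeval v f) : u = v := by
  obtain ⟨k, hk⟩ := exists_aeval_add f u (v - u)
  rw [add_sub_cancel, ← h] at hk
  -- `f(v) - f(u)` is this factor times `v - u`, and its constant term is `f'(u(0))` because `u` and
  -- `v` agree at `T = 0`.
  have hunit : IsUnit (aeval u (derivative f) + k * (v - u)) := by
    rw [PowerSeries.isUnit_iff_constantCoeff, map_add, map_mul, map_sub, h0, sub_self, mul_zero,
      add_zero, constantCoeff_aeval]
    exact hu
  have : (aeval u (derivative f) + k * (v - u)) * (v - u) = 0 := by linear_combination -hk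
  exact (sub_eq_zero.1 ((hunit.mul_right_eq_zero).1 this)).symm

/-- Hensel's lemma for power series: simple roots lift. -/
theorem exists_aeval_powerSeries_eq {R : Type*} [CommRing R] [Nontrivial R] [Algebra F R]
    {f : F[X]} (hf : 0 < f.natDegree) (x : R) (w : PowerSeries R)
    (hx : aeval x f = PowerSeries.constantCoeff w) (hu : IsUnit (aeval x (derivative f))) :
    ∃ u : PowerSeries R, PowerSeries.constantCoeff u = x ∧ aeval u f = w := by
  have hf0 : f ≠ 0 := ne_zero_of_natDegree_gt hf
  have hc : f.leadingCoeff⁻¹ ≠ 0 := inv_ne_zero (leadingCoeff_ne_zero.2 hf0)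
  set c := f.leadingCoeff⁻¹
  set γ : PowerSeries R := algebraMap F (PowerSeries R) c with hγ
  have hγu : IsUnit γ := hc.isUnit.map (algebraMap F (PowerSeries R))
  -- The Henselian property is stated for monic polynomials, so `f - w` is divided by the leading
  -- coefficient of `f`.
  set p : (PowerSeries R)[X] := (f * C c).map (algebraMap F (PowerSeries R)) - C (γ * w) with hp
  have heval : ∀ u, p.eval u = γ * (aeval u f - w) := fun u => by
    rw [hp, eval_sub, eval_map_algebraMap, map_mul, aeval_C, eval_C]
    ring
  have hderiv : p.derivative.eval (PowerSeries.C x) =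
      γ * aeval (PowerSeries.C x) (derivative f) := by
    rw [hp, derivative_sub, derivative_C, sub_zero, derivative_map, eval_map_algebraMap,
      derivative_mul, derivative_C, mul_zero, add_zero, map_mul, aeval_C, mul_comm]
  have hmonic : p.Monic := by
    have hm := (monic_mul_leadingCoeff_inv hf0).map (algebraMap F (PowerSeries R))
    refine hm.sub_of_left (degree_C_le.trans_lt ?_)
    rw [(monic_mul_leadingCoeff_inv hf0).degree_map, degree_mul_leadingCoeff_inv _ hf0]
    exact natDegree_pos_iff_degree_pos.1 hf
  obtain ⟨u, hu1, hu2⟩ := HenselianRing.is_henselian (I := Ideal.span {PowerSeries.X}) p hmonic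
    (PowerSeries.C x) (by
      rw [Ideal.mem_span_singleton, PowerSeries.X_dvd_iff, heval, map_mul, map_sub,
        constantCoeff_aeval, PowerSeries.constantCoeff_C, hx, sub_self, mul_zero])
    (by
      refine IsUnit.map _ ?_
      rw [hderiv]
      refine hγu.mul ?_
      rw [PowerSeries.isUnit_iff_constantCoeff, constantCoeff_aeval, PowerSeries.constantCoeff_C]
      exact hu)
  refine ⟨u, ?_, ?_⟩
  · rwa [Ideal.mem_span_singleton, PowerSeries.X_dvd_iff, map_sub, PowerSeries.constantCoeff_C,
      sub_eq_zero] at hu2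
  · rw [IsRoot.def, heval, hγu.mul_right_eq_zero, sub_eq_zero] at hu1
    exact hu1

/-! ### Hasse derivatives as Taylor homomorphisms -/

namespace IsHasseDerivatives

variable {R : Type*} [CommRing R] [Algebra F R] {t : R} {D : ℕ → R →ₗ[F] R}

theorem mk_mul (hD : IsHasseDerivatives F t D) (a b : R) :
    PowerSeries.mk (fun k => D k (a * b)) =
      PowerSeries.mk (fun k => D k a) * PowerSeries.mk (fun k => D k b) := by
  ext k
  rw [PowerSeries.coeff_mk, PowerSeries.coeff_mul, hD.leibniz]
  simp only [PowerSeries.coeff_mk]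

/-- The expansion of `1` is idempotent and has constant term `1`, hence is a unit, hence is `1`. -/
theorem mk_one (hD : IsHasseDerivatives F t D) : PowerSeries.mk (fun k => D k 1) = 1 := by
  have h := hD.mk_mul 1 1
  rw [mul_one] at h
  have hu : IsUnit (PowerSeries.mk fun k => D k 1) := by
    rw [PowerSeries.isUnit_iff_constantCoeff, ← PowerSeries.coeff_zero_eq_constantCoeff_apply,
      PowerSeries.coeff_mk, hD.zero]
    exact isUnit_one
  exact (hu.mul_eq_left.1 h.symm)

/-- The Taylor expansion `a ↦ ∑ D k a T ^ k` as a homomorphism of algebras. -/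
noncomputable def taylor (hD : IsHasseDerivatives F t D) : R →ₐ[F] PowerSeries R :=
  AlgHom.ofLinearMap
    { toFun := fun a => PowerSeries.mk fun k => D k a
      map_add' := fun a b => by ext; simp
      map_smul' := fun c a => by ext; simp }
    hD.mk_one hD.mk_mul

theorem coeff_taylor (hD : IsHasseDerivatives F t D) (k : ℕ) (a : R) :
    PowerSeries.coeff k (hD.taylor a) = D k a :=
  PowerSeries.coeff_mk k fun k => D k a

theorem constantCoeff_taylor (hD : IsHasseDerivatives F t D) (a : R) :
    PowerSeries.constantCoeff (hD.taylor a) = a := by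
  rw [← PowerSeries.coeff_zero_eq_constantCoeff_apply, coeff_taylor, hD.zero]
  rfl

theorem taylor_coord (hD : IsHasseDerivatives F t D) :
    hD.taylor t = PowerSeries.C t + PowerSeries.X := by
  ext k
  rw [coeff_taylor, map_add, PowerSeries.coeff_C, PowerSeries.coeff_X]
  rcases k with _ | _ | k
  · simp [hD.zero]
  · simp [hD.coord_one]
  · simp [hD.coord_ge_two (k + 1 + 1) (by omega)]

theorem of_algHom (Φ : R →ₐ[F] PowerSeries R)
    (h0 : ∀ a, PowerSeries.constantCoeff (Φ a) = a)
    (ht : Φ t = PowerSeries.C t + PowerSeries.X) :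
    IsHasseDerivatives F t fun k =>
      ((PowerSeries.coeff k : PowerSeries R →ₗ[R] R).restrictScalars F).comp Φ.toLinearMap where
  zero := by
    ext a
    simp [h0]
  leibniz k a b := by
    simp [PowerSeries.coeff_mul]
  coord_one := by simp [ht]
  coord_ge_two k hk := by
    simp [ht, PowerSeries.coeff_C, PowerSeries.coeff_X, show k ≠ 0 by omega, show k ≠ 1 by omega]

end IsHasseDerivatives

/-! ### The local ring at a ramification point -/

section LocalRing

variable {f : F[X]} (P : Ideal (CoordRing f)) [P.IsPrime]

theorem aeval_localization (p : F[X]) :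
    aeval (algebraMap _ (Localization.AtPrime P) (xCoord f)) p =
      algebraMap _ (Localization.AtPrime P) (algebraMap F[X] (CoordRing f) p) := by
  rw [aeval_algebraMap_apply, ← algebraMap_X, aeval_algebraMap_apply, aeval_X_left_apply]

theorem aeval_localization_self :
    aeval (algebraMap _ (Localization.AtPrime P) (xCoord f)) f =
      algebraMap _ (Localization.AtPrime P) (yCoord f) ^ 2 := by
  rw [aeval_localization, ← yCoord_sq, map_pow]

variable {P}

/-- In a Bézout relation `a f + b f' = 1`, the term with `f = y²` lies in `P`, so `f'(x)` cannot. -/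
theorem isUnit_derivative (hf : f.Separable) (hy : yCoord f ∈ P) :
    IsUnit (aeval (algebraMap _ (Localization.AtPrime P) (xCoord f)) (derivative f)) := by
  rw [aeval_localization, IsLocalization.AtPrime.isUnit_to_map_iff _ P]
  intro h
  obtain ⟨a, b, hab⟩ := hf
  have := congrArg (algebraMap F[X] (CoordRing f)) hab
  rw [map_add, map_mul, map_mul, ← yCoord_sq, map_one] at this
  refine Ideal.IsPrime.ne_top' (I := P) ((Ideal.eq_top_iff_one _).2 ?_)
  rw [← this]
  exact P.add_mem (P.mul_mem_left _ (P.pow_mem_of_mem hy 2 (by norm_num))) (P.mul_mem_left _ h)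

/-- It suffices to treat `a(x) ∈ P`. Put `d = gcd(a, f)`, `f = d h`, `a = d q`. Then `d ∈ P`, and
separability makes `d` and `h` coprime, so `h` becomes a unit; finally `a h = f q = y² q`. -/
theorem maximalIdeal_eq_span (hf : f.Separable) (hy : yCoord f ∈ P) :
    IsLocalRing.maximalIdeal (Localization.AtPrime P) =
      Ideal.span {algebraMap _ (Localization.AtPrime P) (yCoord f)} := by
  classical
  rw [← Localization.AtPrime.map_eq_maximalIdeal]
  apply le_antisymm
  · rw [Ideal.map_le_iff_le_comap]
    intro u hu
    obtain ⟨a, b, rfl⟩ := exists_repr f u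
    have ha : algebraMap F[X] (CoordRing f) a ∈ P := by
      simpa using P.sub_mem hu (P.mul_mem_left (algebraMap F[X] _ b) hy)
    rw [Ideal.mem_comap, map_add, map_mul]
    refine Ideal.add_mem _ ?_ (Ideal.mul_mem_left _ _ (Ideal.mem_span_singleton_self _))
    set d := EuclideanDomain.gcd a f with hd
    have hdP : algebraMap F[X] (CoordRing f) d ∈ P := by
      rw [hd, EuclideanDomain.gcd_eq_gcd_ab, map_add, map_mul, map_mul, ← yCoord_sq]
      exact P.add_mem (P.mul_mem_right _ ha)
        (P.mul_mem_right _ (P.pow_mem_of_mem hy 2 (by norm_num)))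
    obtain ⟨h, hh⟩ := EuclideanDomain.gcd_dvd_right a f
    obtain ⟨q, hq⟩ := EuclideanDomain.gcd_dvd_left a f
    rw [← hd] at hh hq
    have hhP : algebraMap F[X] (CoordRing f) h ∉ P := by
      intro hhP
      obtain ⟨r, s, hrs⟩ := (hh ▸ hf).isCoprime
      have := congrArg (algebraMap F[X] (CoordRing f)) hrs
      rw [map_add, map_mul, map_mul, map_one] at this
      refine Ideal.IsPrime.ne_top' (I := P) ((Ideal.eq_top_iff_one _).2 ?_)
      rw [← this]
      exact P.add_mem (P.mul_mem_left _ hdP) (P.mul_mem_left _ hhP)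
    have hunit := (IsLocalization.AtPrime.isUnit_to_map_iff (Localization.AtPrime P) P _).2 hhP
    rw [← Ideal.mul_unit_mem_iff_mem _ hunit, ← map_mul, ← map_mul, hq,
      show d * q * h = f * q by rw [mul_right_comm, ← hh], map_mul, ← yCoord_sq, map_mul, map_pow,
      pow_two (algebraMap _ (Localization.AtPrime P) (yCoord f)), mul_assoc]
    exact Ideal.mul_mem_right _ _ (Ideal.mem_span_singleton_self _)
  · rw [Ideal.span_singleton_le_iff_mem]
    exact Ideal.mem_map_of_mem _ hy

/-- Two Taylor homomorphisms agree on `y` by definition and on `x` by uniqueness of the lifted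
simple root, and `x`, `y` determine a homomorphism on the localization. -/
theorem isHasseDerivatives_unique (hf : f.Separable) (hy : yCoord f ∈ P)
    {D D' : ℕ → Localization.AtPrime P →ₗ[F] Localization.AtPrime P}
    (hD : IsHasseDerivatives F (algebraMap _ (Localization.AtPrime P) (yCoord f)) D)
    (hD' : IsHasseDerivatives F (algebraMap _ (Localization.AtPrime P) (yCoord f)) D') :
    D = D' := by
  have hyy : hD.taylor (algebraMap _ (Localization.AtPrime P) (yCoord f)) =
      hD'.taylor (algebraMap _ (Localization.AtPrime P) (yCoord f)) := by
    rw [hD.taylor_coord, hD'.taylor_coord]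
  have hx : hD.taylor (algebraMap _ (Localization.AtPrime P) (xCoord f)) =
      hD'.taylor (algebraMap _ (Localization.AtPrime P) (xCoord f)) := by
    apply aeval_powerSeries_injective (f := f)
    · rw [hD.constantCoeff_taylor, hD'.constantCoeff_taylor]
    · rw [hD.constantCoeff_taylor]
      exact isUnit_derivative hf hy
    · rw [aeval_algHom_apply hD.taylor, aeval_algHom_apply hD'.taylor, aeval_localization_self, map_pow, map_pow, hyy]
  have hpoly : ∀ p : F[X],
      hD.taylor (algebraMap _ (Localization.AtPrime P) (algebraMap F[X] (CoordRing f) p)) =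
      hD'.taylor (algebraMap _ (Localization.AtPrime P) (algebraMap F[X] (CoordRing f) p)) := by
    intro p
    rw [← aeval_localization, ← aeval_algHom_apply hD.taylor, ← aeval_algHom_apply hD'.taylor, hx]
  have h : (hD.taylor : Localization.AtPrime P →+* PowerSeries (Localization.AtPrime P)) =
      hD'.taylor := by
    apply IsLocalization.ringHom_ext P.primeCompl
    refine RingHom.ext fun u => ?_
    obtain ⟨a, b, rfl⟩ := exists_repr f u
    simp only [RingHom.comp_apply, RingHom.coe_coe, map_add, map_mul, hpoly, hyy]
  funext k
  ext a
  rw [← hD.coeff_taylor, ← hD'.coeff_taylor]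
  exact congrArg (PowerSeries.coeff k) (RingHom.congr_fun h a)

theorem exists_isHasseDerivatives (hdeg : 0 < f.natDegree) (hf : f.Separable) (hy : yCoord f ∈ P) :
    ∃ D : ℕ → Localization.AtPrime P →ₗ[F] Localization.AtPrime P,
      IsHasseDerivatives F (algebraMap _ (Localization.AtPrime P) (yCoord f)) D := by
  set x := algebraMap _ (Localization.AtPrime P) (xCoord f)
  set y := algebraMap _ (Localization.AtPrime P) (yCoord f)
  obtain ⟨u, hu0, hu⟩ := exists_aeval_powerSeries_eq hdeg x
    ((PowerSeries.C y + PowerSeries.X) ^ 2) (by simp [x, y, aeval_localization_self])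
    (isUnit_derivative hf hy)
  -- The Hensel lift `u` of `x` satisfies `f(u) = (y + T)²`, the only relation to check. Elements
  -- outside `P` then map to series with unit constant term, so `ψ` extends to the localization.
  let ψ : CoordRing f →ₐ[F] PowerSeries (Localization.AtPrime P) :=
    AdjoinRoot.liftAlgHom (X ^ 2 - C f : F[X][X]) (aeval u) (PowerSeries.C y + PowerSeries.X)
      (by simp [hu])
  have hψy : ψ (yCoord f) = PowerSeries.C y + PowerSeries.X := AdjoinRoot.liftAlgHom_root ..
  have hψp : ∀ p : F[X], ψ (algebraMap F[X] (CoordRing f) p) = aeval u p := fun p =>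
    AdjoinRoot.liftAlgHom_of ..
  have hψ0 : ∀ a, PowerSeries.constantCoeff (ψ a) = algebraMap _ (Localization.AtPrime P) a := by
    intro a
    obtain ⟨p, q, rfl⟩ := exists_repr f a
    simp only [map_add, map_mul, hψy, hψp, constantCoeff_aeval, hu0]
    simp [x, y, aeval_localization]
  have hψu : ∀ s : P.primeCompl, IsUnit (ψ s) := fun s => by
    rw [PowerSeries.isUnit_iff_constantCoeff, hψ0]
    exact IsLocalization.map_units _ s
  let Φ : Localization.AtPrime P →ₐ[F] PowerSeries (Localization.AtPrime P) :=
    IsLocalization.liftAlgHom (M := P.primeCompl) hψu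
  have hΦ : ∀ a, Φ (algebraMap _ _ a) = ψ a := fun a => IsLocalization.lift_eq hψu a
  refine ⟨_, IsHasseDerivatives.of_algHom Φ ?_ ((hΦ _).trans hψy)⟩
  have h : (PowerSeries.constantCoeff : PowerSeries (Localization.AtPrime P) →+* _).comp
      (Φ : Localization.AtPrime P →+* _) = RingHom.id _ := by
    apply IsLocalization.ringHom_ext P.primeCompl
    refine RingHom.ext fun a => ?_
    simp [hΦ, hψ0]
  exact RingHom.congr_fun h

end LocalRing

/-! ### Comparison of lowest-order terms -/

theorem sameLowestOrderTerm_pow_mul {R : Type*} [CommRing R] [IsDomain R] [IsLocalRing R] {y : R}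
    (hm : IsLocalRing.maximalIdeal R = Ideal.span {y}) (hy : y ≠ 0) (n : ℕ) {u v : R}
    (hu : IsLocalRing.residue R u ≠ 0)
    (huv : IsLocalRing.residue R u = IsLocalRing.residue R v) :
    SameLowestOrderTerm (y ^ n * u) (y ^ n * v) := by
  have hiff : ∀ w, y ^ n * w ∈ IsLocalRing.maximalIdeal R ^ (n + 1) ↔
      IsLocalRing.residue R w = 0 := by
    intro w
    rw [IsLocalRing.residue_eq_zero_iff, hm, Ideal.span_singleton_pow, Ideal.mem_span_singleton,
      Ideal.mem_span_singleton, pow_succ, mul_dvd_mul_iff_left (pow_ne_zero n hy)]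
  have hmem : ∀ w, y ^ n * w ∈ IsLocalRing.maximalIdeal R ^ n := by
    intro w
    rw [hm, Ideal.span_singleton_pow, Ideal.mem_span_singleton]
    exact dvd_mul_right _ _
  refine ⟨n, hmem u, ?_, hmem v, ?_, ?_⟩
  · rwa [hiff]
  · rwa [hiff, ← huv]
  · rw [← mul_sub, hiff, map_sub, huv, sub_self]

theorem sameLowestOrderTerm_hasseWronskian_of_aeval_eq_sq {R : Type*} [CommRing R] [IsDomain R]
    [IsLocalRing R] [Algebra F R] (h2 : (2 : F) ≠ 0) {g ℓ : ℕ} (hgl : g < ℓ) {f : F[X]} {x y : R}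
    (hroot : aeval x f = y ^ 2) (hunit : IsUnit (aeval x (derivative f)))
    (hmax : IsLocalRing.maximalIdeal R = Ideal.span {y}) (hy0 : y ≠ 0)
    {D : ℕ → R →ₗ[F] R} (hD : IsHasseDerivatives F y D)
    (hM : (((pathMatrix g ℓ).det : ℤ) : F) ≠ 0) :
    SameLowestOrderTerm
      (hasseWronskian D fun j : Fin (2 * ℓ - g + 1) => x ^ xExp (ℓ - g) j * y ^ yExp (ℓ - g) j)
      ((((pathMatrix g ℓ).det : ℤ) : R) * D 1 x ^ (g + 1).choose 2 * D 2 x ^ (ℓ * (ℓ - g))) := by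
  set ρ := IsLocalRing.residue R
  have hρy : ρ y = 0 := by
    rw [IsLocalRing.residue_eq_zero_iff, hmax]
    exact Ideal.mem_span_singleton_self y
  -- the first two derivatives of `x`
  have hexp : ∃ k : PowerSeries R,
      (PowerSeries.C y + PowerSeries.X) ^ 2 = PowerSeries.C (y ^ 2) +
        PowerSeries.C (aeval x (derivative f)) * (hD.taylor x - PowerSeries.C x) +
        k * (hD.taylor x - PowerSeries.C x) ^ 2 := by
    have hC : ∀ p : F[X], aeval (PowerSeries.C x) p = PowerSeries.C (aeval x p) := fun p => by
      rw [aeval_def, aeval_def, hom_eval₂]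
      congr 1
      ext r
      rw [RingHom.comp_apply, PowerSeries.algebraMap_apply]
    obtain ⟨k, hk⟩ := exists_aeval_add f (PowerSeries.C x) (hD.taylor x - PowerSeries.C x)
    refine ⟨k, ?_⟩
    rw [add_sub_cancel, aeval_algHom_apply hD.taylor, hC, hC, hroot, map_pow, hD.taylor_coord] at hk
    exact hk
  obtain ⟨k, hk⟩ := hexp
  obtain ⟨v, hv⟩ : PowerSeries.X ∣ hD.taylor x - PowerSeries.C x := by
    rw [PowerSeries.X_dvd_iff, map_sub, hD.constantCoeff_taylor, PowerSeries.constantCoeff_C,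
      sub_self]
  have hv1 : D 1 x = PowerSeries.coeff 0 v := by
    have := congrArg (PowerSeries.coeff 1) hv
    rwa [PowerSeries.coeff_succ_X_mul, map_sub, hD.coeff_taylor, PowerSeries.coeff_C,
      if_neg one_ne_zero, sub_zero] at this
  have hv2 : D 2 x = PowerSeries.coeff 1 v := by
    have := congrArg (PowerSeries.coeff 2) hv
    rwa [PowerSeries.coeff_succ_X_mul, map_sub, hD.coeff_taylor, PowerSeries.coeff_C,
      if_neg two_ne_zero, sub_zero] at this
  rw [hv] at hk
  -- The expansion of `f(x + v) = (y + T)²` with `f(x) = y²` removed and one factor `T` cancelled;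
  -- its coefficients in degrees 0 and 1 give `D 1 x` and the residue of `D 2 x`.
  have hk' : PowerSeries.C (2 * y) + PowerSeries.X =
      PowerSeries.C (aeval x (derivative f)) * v + PowerSeries.X * (k * v ^ 2) := by
    apply mul_left_cancel₀ (PowerSeries.X_ne_zero (R := R))
    rw [map_pow] at hk
    rw [map_mul, map_ofNat]
    linear_combination hk
  have h1 : aeval x (derivative f) * D 1 x = 2 * y := by
    have := congrArg (PowerSeries.coeff 0) hk'
    simp at this
    rw [hv1, PowerSeries.coeff_zero_eq_constantCoeff_apply]
    exact this.symm
  have hρ1 : ρ (D 1 x) = 0 := by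
    have := congrArg ρ h1
    rw [map_mul, map_mul, hρy, mul_zero] at this
    exact (hunit.map ρ).mul_right_eq_zero.1 this
  have hρ2 : ρ (aeval x (derivative f)) * ρ (D 2 x) = 1 := by
    have := congrArg (PowerSeries.coeff 1) hk'
    rw [map_add, map_add, PowerSeries.coeff_C, if_neg one_ne_zero, PowerSeries.coeff_one_X,
      PowerSeries.coeff_C_mul, PowerSeries.coeff_succ_X_mul, ← hv2,
      PowerSeries.coeff_zero_eq_constantCoeff_apply, map_mul, map_pow,
      ← PowerSeries.coeff_zero_eq_constantCoeff_apply v, ← hv1] at this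
    have := congrArg ρ this
    simp only [map_add, map_mul, map_pow, hρ1, map_zero, map_one] at this
    linear_combination -this
  obtain ⟨d, hd⟩ := hunit
  -- `c = 2 / f'(x)`, a unit because the characteristic is not 2.
  obtain ⟨c, hc⟩ : ∃ c, c = 2 * ((d⁻¹ : Rˣ) : R) := ⟨_, rfl⟩
  have hc1 : D 1 x = y * c := by
    rw [hc, ← d.inv_mul_cancel_left (D 1 x), hd, h1]
    ring
  have hcast : ∀ r : F, r ≠ 0 → ρ (algebraMap F _ r) ≠ 0 := fun r hr =>
    ((hr.isUnit.map (algebraMap F R)).map ρ).ne_zero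
  have hρc : ρ c ≠ 0 := by
    have := hcast 2 h2
    rw [map_ofNat] at this
    rw [hc, map_mul]
    exact mul_ne_zero this ((d⁻¹).isUnit.map ρ).ne_zero
  have hρ2' : ρ (D 2 x) ≠ 0 := right_ne_zero_of_mul_eq_one hρ2
  obtain ⟨m, rfl⟩ := Nat.exists_eq_add_of_lt hgl
  obtain ⟨W, hW, hρW⟩ := exists_det_eq_pow_mul ρ hy0 hρy
    (show 2 * (g + m + 1) - g + 1 = 2 * (m + 1) + (g + 1) by omega) (hD.taylor x) (c := c)
    (by rw [hD.coeff_taylor, hc1]) hρc (by rwa [hD.coeff_taylor])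
  have hw : hasseWronskian D (fun j : Fin (2 * (g + m + 1) - g + 1) =>
      x ^ xExp (g + m + 1 - g) j * y ^ yExp (g + m + 1 - g) j) = y ^ (g + 1).choose 2 * W := by
    rw [← hW, hasseWronskian]
    congr 1
    ext k j
    rw [Matrix.of_apply, Matrix.of_apply, ← hD.coeff_taylor, map_mul, map_pow, map_pow,
      hD.taylor_coord, show g + m + 1 - g = m + 1 by omega]
  have hdetM : ρ (((pathMatrix g (g + m + 1)).det : ℤ) : R) ≠ 0 := by
    have := hcast _ hM
    rwa [map_intCast] at this
  rw [hw, hc1, mul_pow, show ∀ a b e p : R, a * (p * b) * e = p * (a * b * e)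
    from fun a b e p => by ring]
  have hρeq : ρ W = ρ ((((pathMatrix g (g + m + 1)).det : ℤ) : R) *
      c ^ (g + 1).choose 2 * D 2 x ^ ((g + m + 1) * (g + m + 1 - g))) := by
    rw [hρW, map_mul, map_mul, map_pow, map_pow, map_intCast, hD.coeff_taylor,
      show g + m + 1 - g = m + 1 by omega]
    rfl
  refine sameLowestOrderTerm_pow_mul hmax hy0 _ ?_ hρeq
  rw [hρeq, map_mul, map_mul, map_pow, map_pow]
  exact mul_ne_zero (mul_ne_zero hdetM (pow_ne_zero _ hρc)) (pow_ne_zero _ hρ2')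

theorem sameLowestOrderTerm_hasseWronskian (h2 : (2 : F) ≠ 0) {g ℓ : ℕ} (hgl : g < ℓ) {f : F[X]}
    (hdeg : f.natDegree = 2 * g + 1) (hf : f.Separable) {P : Ideal (CoordRing f)} [P.IsPrime]
    (hy : yCoord f ∈ P) {D : ℕ → Localization.AtPrime P →ₗ[F] Localization.AtPrime P}
    (hD : IsHasseDerivatives F (algebraMap _ (Localization.AtPrime P) (yCoord f)) D)
    (hM : (((pathMatrix g ℓ).det : ℤ) : F) ≠ 0) :
    SameLowestOrderTerm
      (hasseWronskian D fun j => algebraMap _ (Localization.AtPrime P) (monomials f g ℓ j))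
      ((((pathMatrix g ℓ).det : ℤ) : Localization.AtPrime P) *
        D 1 (algebraMap _ (Localization.AtPrime P) (xCoord f)) ^ (g + 1).choose 2 *
        D 2 (algebraMap _ (Localization.AtPrime P) (xCoord f)) ^ (ℓ * (ℓ - g))) := by
  have := isDomain_coordRing (f := f) ⟨g, hdeg⟩
  have : IsDomain (Localization.AtPrime P) :=
    IsLocalization.isDomain_localization P.primeCompl_le_nonZeroDivisors
  have hy0 : algebraMap _ (Localization.AtPrime P) (yCoord f) ≠ 0 := by
    rw [Ne, IsLocalization.to_map_eq_zero_iff _ P.primeCompl_le_nonZeroDivisors]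
    exact yCoord_ne_zero f
  have h := sameLowestOrderTerm_hasseWronskian_of_aeval_eq_sq h2 hgl (aeval_localization_self P)
    (isUnit_derivative hf hy) (maximalIdeal_eq_span hf hy) hy0 hD hM
  have hmon : (fun j => algebraMap _ (Localization.AtPrime P) (monomials f g ℓ j)) =
      fun j : Fin (2 * ℓ - g + 1) => algebraMap _ (Localization.AtPrime P) (xCoord f) ^ xExp (ℓ - g) j *
        algebraMap _ (Localization.AtPrime P) (yCoord f) ^ yExp (ℓ - g) j := by
    funext j
    rw [monomials_eq, map_mul, map_pow, map_pow]
  rw [hmon]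
  exact h

end HyperellipticInflection

theorem theorem3p8 {F : Type*} [Field F] (h2 : (2 : F) ≠ 0) (g ℓ : ℕ) (hgl : g < ℓ)
    (f : Polynomial F) (hdeg : f.natDegree = 2 * g + 1) (hsmooth : f.Separable) :
    -- the monomials form a basis of the complete linear series
    (LinearIndependent F (HyperellipticInflection.monomials f g ℓ) ∧
      Submodule.span F (Set.range (HyperellipticInflection.monomials f g ℓ)) =
        HyperellipticInflection.globalSections f g ℓ) ∧
    -- the ramification points other than the one at infinity are the points with `y = 0`
    ∀ (P : Ideal (HyperellipticInflection.CoordRing f)) [P.IsPrime],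
      HyperellipticInflection.yCoord f ∈ P →
      -- the Hasse derivatives with respect to `y` on the local ring exist and are unique
      (∃! D : ℕ → Localization.AtPrime P →ₗ[F] Localization.AtPrime P,
        HyperellipticInflection.IsHasseDerivatives F
          (algebraMap _ (Localization.AtPrime P) (HyperellipticInflection.yCoord f)) D) ∧
      ∀ D : ℕ → Localization.AtPrime P →ₗ[F] Localization.AtPrime P,
        HyperellipticInflection.IsHasseDerivatives F
          (algebraMap _ (Localization.AtPrime P) (HyperellipticInflection.yCoord f)) D →
        (((HyperellipticInflection.pathMatrix g ℓ).det : ℤ) : F) ≠ 0 →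
        HyperellipticInflection.SameLowestOrderTerm
          (HyperellipticInflection.hasseWronskian D fun j =>
            algebraMap _ (Localization.AtPrime P) (HyperellipticInflection.monomials f g ℓ j))
          ((((HyperellipticInflection.pathMatrix g ℓ).det : ℤ) : Localization.AtPrime P) *
            D 1 (algebraMap _ (Localization.AtPrime P) (HyperellipticInflection.xCoord f)) ^
              (g + 1).choose 2 *
            D 2 (algebraMap _ (Localization.AtPrime P) (HyperellipticInflection.xCoord f)) ^
              (ℓ * (ℓ - g))) := by

  refine ⟨⟨HyperellipticInflection.linearIndependent_monomials f g ℓ,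
    HyperellipticInflection.span_monomials hgl hdeg⟩, fun P _ hy => ⟨?_, fun D hD hM =>
    HyperellipticInflection.sameLowestOrderTerm_hasseWronskian h2 hgl hdeg hsmooth hy hD hM⟩⟩
  obtain ⟨D, hD⟩ := HyperellipticInflection.exists_isHasseDerivatives (by omega) hsmooth hy
  exact ⟨D, hD, fun D' hD' => HyperellipticInflection.isHasseDerivatives_unique hsmooth hy hD' hD⟩
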